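/- Let $p$ be a prime number and let $\mathbb C$ be a complete, non-archimedean, algebraically closed field of mixed characteristic $(0,p)$, with ring of integers $\mathcal O$ and residue field $k$. Let $\mathcal O^\flat:=\varprojlim_{x\mapsto x^p}\mathcal O/p\mathcal O$ be the tilt of $\mathcal O$ and let $\mathbb A_{\mathrm{inf}}:=W(\mathcal O^\flat)$ be its ring of $p$-typical Witt vectors. Regard $W(k)$ as an $\mathbb A_{\mathrm{inf}}$-algebra via the ring homomorphism $\mathbb A_{\mathrm{inf}}\to W(k)$ induced by the projection $\mathcal O^\flat\to\mathcal O/p\mathcal O\to k$, $(x_0,x_1,\dots)\mapsto x_0 \bmod \mathfrak m$ (where $\mathfrak m$ is the maximal ideal of $\mathcal O$), and regard $\mathcal O$ as an $\mathbb A_{\mathrm{inf}}$-algebra via Fontaine's map $\theta:\mathbb A_{\mathrm{inf}}\to\mathcal O$. Let $M$ be a finitely presented $\mathbb A_{\mathrm{inf}}$-module such that $M[\tfrac1p]$ is finite free over $\mathbb A_{\mathrm{inf}}[\tfrac1p]$. Then: 1. $M\otimes_{\mathbb A_{\mathrm{inf}}}W(k)$ is $p$-torsion-free (i.e. multiplication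 by $p$ on it is injective) if and only if it is finite free over $W(k)$. 2. $M\otimes_{\mathbb A_{\mathrm{inf}}}\mathcal O$ is $p$-torsion-free if and only if it is finite free over $\mathcal O$. 3. If $M\otimes_{\mathbb A_{\mathrm{inf}}}W(k)$ or $M\otimes_{\mathbb A_{\mathrm{inf}}}\mathcal O$ is $p$-torsion-free, then $M$ is a finite free $\mathbb A_{\mathrm{inf}}$-module. -/

import Mathlib

open scoped TensorProduct

noncomputable section

namespace AinfModules

universe u

section Rings

variable (C : Type u) [NormedField C] [IsUltrametricDist C]

/-- The ring of integers `𝒪 = {x : ‖x‖ ≤ 1}` of a non-archimedean field `C`. -/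
abbrev Integers : Type u := (NormedField.valuation (K := C)).valuationSubring

/-- The residue field `k` of `𝒪`. -/
abbrev Residue : Type u := IsLocalRing.ResidueField (Integers C)

theorem norm_integers_le_one (x : Integers C) : ‖(x : C)‖ ≤ 1 := by
  have h : NormedField.valuation (x : C) ≤ 1 := x.2
  exact_mod_cast h

variable (p : ℕ)

theorem prime_mem_maximalIdeal [CharP (Residue C) p] :
    (p : Integers C) ∈ IsLocalRing.maximalIdeal (Integers C) := by
  rw [← IsLocalRing.residue_eq_zero_iff, map_natCast, CharP.cast_eq_zero]

theorem residue_eq_zero_of_mem_span [CharP (Residue C) p] (x : Integers C)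
    (hx : x ∈ Ideal.span {(p : Integers C)}) : IsLocalRing.residue (Integers C) x = 0 :=
  (IsLocalRing.residue_eq_zero_iff x).2
    ((Ideal.span_singleton_le_iff_mem _).2 (prime_mem_maximalIdeal C p) hx)

instance fact_not_isUnit [CharP (Residue C) p] : Fact (¬ IsUnit (p : Integers C)) :=
  ⟨(IsLocalRing.mem_maximalIdeal _).1 (prime_mem_maximalIdeal C p)⟩

theorem norm_prime_lt_one [CharP (Residue C) p] : ‖(p : C)‖ < 1 := by
  refine lt_of_le_of_ne (by simpa using norm_integers_le_one C (p : Integers C)) fun h => ?_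
  refine (fact_not_isUnit C p).out ?_
  have hne : (p : C) ≠ 0 := by
    intro h0
    simp [h0] at h
  have hmem : (p : C)⁻¹ ∈ (NormedField.valuation (K := C)).valuationSubring := by
    rw [Valuation.mem_valuationSubring_iff, map_inv₀]
    have : NormedField.valuation (p : C) = 1 := by
      ext
      simpa using h
    simp [this]
  refine IsUnit.of_mul_eq_one (⟨(p : C)⁻¹, hmem⟩ : Integers C) ?_
  ext
  simp [hne]

theorem mem_span_prime_pow_iff [CharZero C] [Fact p.Prime] (n : ℕ) (x : Integers C) :
    x ∈ Ideal.span {(p : Integers C)} ^ n ↔ ‖(x : C)‖ ≤ ‖(p : C)‖ ^ n := by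
  have hne : (p : C) ≠ 0 := Nat.cast_ne_zero.2 (Fact.out : p.Prime).ne_zero
  rw [Ideal.span_singleton_pow, Ideal.mem_span_singleton]
  constructor
  · rintro ⟨y, rfl⟩
    have := norm_integers_le_one C y
    simpa using mul_le_mul_of_nonneg_left this (norm_nonneg ((p : C) ^ n))
  · intro h
    have hpos : 0 < ‖(p : C)‖ ^ n := pow_pos (norm_pos_iff.2 hne) n
    have hmem : (x : C) / (p : C) ^ n ∈ (NormedField.valuation (K := C)).valuationSubring := by
      rw [Valuation.mem_valuationSubring_iff]
      have : ‖(x : C) / (p : C) ^ n‖ ≤ 1 := by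
        rw [norm_div, norm_pow]
        exact (div_le_one hpos).2 h
      exact_mod_cast this
    refine ⟨⟨_, hmem⟩, ?_⟩
    ext
    simp [mul_div_cancel₀, hne]

/-- The ring of integers of a complete field of mixed characteristic is `p`-adically complete. -/
instance isAdicComplete_integers [CompleteSpace C] [CharZero C] [Fact p.Prime]
    [CharP (Residue C) p] :
    IsAdicComplete (Ideal.span {(p : Integers C)}) (Integers C) where
  haus' := by
    intro x hx
    have h : ∀ n : ℕ, ‖(x : C)‖ ≤ ‖(p : C)‖ ^ n := fun n => by
      have := hx n
      rw [SModEq.zero, smul_eq_mul, Ideal.mul_top] at this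
      exact (mem_span_prime_pow_iff C p n x).1 this
    have h0 : ‖(x : C)‖ ≤ 0 := ge_of_tendsto'
      (tendsto_pow_atTop_nhds_zero_of_lt_one (norm_nonneg _) (norm_prime_lt_one C p)) h
    ext
    simpa using h0
  prec' := by
    intro f hf
    have h : ∀ m n : ℕ, m ≤ n → ‖(f m : C) - f n‖ ≤ ‖(p : C)‖ ^ m := fun m n hmn => by
      have := hf hmn
      rw [SModEq.sub_mem, smul_eq_mul, Ideal.mul_top] at this
      simpa using (mem_span_prime_pow_iff C p m _).1 this
    have hlim := tendsto_pow_atTop_nhds_zero_of_lt_one (norm_nonneg _) (norm_prime_lt_one C p)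
    have hc : CauchySeq fun n => (f n : C) :=
      cauchySeq_of_le_tendsto_0' (fun n => ‖(p : C)‖ ^ n)
        (fun m n hmn => by rw [dist_eq_norm]; exact h m n hmn) hlim
    obtain ⟨L, hL⟩ := cauchySeq_tendsto_of_complete hc
    have hL1 : ‖L‖ ≤ 1 := le_of_tendsto' hL.norm fun n => norm_integers_le_one C (f n)
    have hmem : L ∈ (NormedField.valuation (K := C)).valuationSubring := by
      rw [Valuation.mem_valuationSubring_iff]
      exact_mod_cast hL1
    refine ⟨⟨L, hmem⟩, fun n => ?_⟩
    rw [SModEq.sub_mem, smul_eq_mul, Ideal.mul_top, mem_span_prime_pow_iff]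
    have ht : Filter.Tendsto (fun m => ‖(f n : C) - f m‖) Filter.atTop (nhds ‖(f n : C) - L‖) :=
      (tendsto_const_nhds.sub hL).norm
    refine le_of_tendsto ht ?_
    filter_upwards [Filter.eventually_ge_atTop n] with m hm using h n m hm

variable [Fact p.Prime] [CharP (Residue C) p]

/-- The tilt `𝒪♭`, the inverse limit of `𝒪/p` along Frobenius. -/
abbrev TiltIntegers : Type u := PreTilt (Integers C) p

/-- Fontaine's period ring `𝔸_inf = W(𝒪♭)`. -/
abbrev Ainf : Type u := WittVector p (TiltIntegers C p)

/-- The ring `W(k)` of Witt vectors of the residue field. -/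
abbrev WittResidue : Type u := WittVector p (Residue C)

/-- The projection `𝒪♭ → 𝒪/p → k`, where the first map sends `(x₀, x₁, …)` to `x₀`. -/
def tiltToResidue : TiltIntegers C p →+* Residue C :=
  (Ideal.Quotient.lift (Ideal.span {(p : Integers C)}) (IsLocalRing.residue (Integers C))
    (residue_eq_zero_of_mem_span C p)).comp
    (PreTilt.coeff 0)

/-- The crystalline specialisation `𝔸_inf → W(k)`. -/
def crystallineMap : Ainf C p →+* WittResidue C p :=
  WittVector.map (tiltToResidue C p)

/-- `W(k)` as an `𝔸_inf`-algebra along the crystalline specialisation. -/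
instance algebraWittResidue : Algebra (Ainf C p) (WittResidue C p) :=
  (crystallineMap C p).toAlgebra

/-- `𝒪` as an `𝔸_inf`-algebra along Fontaine's map `θ`, characterised by `θ([x]) = x⁽⁰⁾`. -/
instance algebraIntegers [CompleteSpace C] [CharZero C] : Algebra (Ainf C p) (Integers C) :=
  (WittVector.fontaineTheta (Integers C) p).toAlgebra

end Rings

/-- Multiplication by `p` is injective on `N`. -/
def IsPTorsionFree (p : ℕ) (N : Type*) [AddCommGroup N] : Prop :=
  ∀ x : N, p • x = 0 → x = 0

/-- `N` is a finite free `R`-module. -/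
def IsFiniteFree (R : Type*) [CommRing R] (N : Type*) [AddCommGroup N] [Module R N] : Prop :=
  Module.Finite R N ∧ Module.Free R N

end AinfModules

end

namespace AinfModules

universe u

/-! ### Descending freeness along a surjective local homomorphism. -/

section CommutativeAlgebra

variable {A B M : Type*} [CommRing A] [CommRing B] [Algebra A B] [AddCommGroup M] [Module A M]

/-! Let `B` be `W(k)` or `𝒪`. It is a valuation ring in which every nonzero element divides a power
of `p`, so for finite modules `p`-torsion-free means torsion-free, hence flat, hence free
(`IsPTorsionFree.free`).

For the third claim, `𝔸_inf → B` is surjective and local, and `p` is nonzero in `B`. Lift a basis of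
`B ⊗ M` to `M`; by Nakayama the lifts generate `M`. Their number is the rank of `M[1/p]`, since both
ranks are computed over `Frac B`. Generators of a finite free module, as many as its rank, are
independent, so the lifts have no relation over `𝔸_inf[1/p]`, hence none over `𝔸_inf`, where `p` is
a nonzerodivisor (`free_of_free_localizedModule_of_free_tensorProduct`). -/

theorem ker_algebraMap_le_jacobson [IsLocalHom (algebraMap A B)] :
    RingHom.ker (algebraMap A B) ≤ Ideal.jacobson ⊥ := by
  intro x hx
  rw [Ideal.mem_jacobson_bot]
  intro y
  refine isUnit_of_map_unit (algebraMap A B) _ ?_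
  simp [(RingHom.mem_ker).1 hx]

/-- Nakayama's lemma for base change along a surjective local homomorphism. -/
theorem subsingleton_of_subsingleton_tensorProduct [IsLocalHom (algebraMap A B)]
    (hsurj : Function.Surjective (algebraMap A B)) [Module.Finite A M]
    [Subsingleton (B ⊗[A] M)] : Subsingleton M := by
  let I := RingHom.ker (Algebra.ofId A B)
  let e : (A ⧸ I) ≃ₐ[A] B := Ideal.quotientKerAlgEquivOfSurjective (f := Algebra.ofId A B) hsurj
  let e' : B ⊗[A] M ≃ₗ[A] M ⧸ I • (⊤ : Submodule A M) :=
    (LinearEquiv.rTensor M e.symm.toLinearEquiv).trans (TensorProduct.quotTensorEquivQuotSMul M I)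
  have hs : Subsingleton (M ⧸ I • (⊤ : Submodule A M)) := e'.symm.toEquiv.subsingleton
  rw [Submodule.Quotient.subsingleton_iff] at hs
  have hbot : (⊤ : Submodule A M) = ⊥ :=
    Submodule.eq_bot_of_le_smul_of_le_jacobson_bot I ⊤ Module.Finite.fg_top hs.ge
      ker_algebraMap_le_jacobson
  exact (Submodule.subsingleton_iff A).1 (subsingleton_of_bot_eq_top hbot.symm)

/-- Nakayama applied to `M ⧸ N`: the base-changed quotient map is surjective yet kills a generating
set. -/
theorem span_eq_top_of_span_one_tmul_eq_top [IsLocalHom (algebraMap A B)]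
    (hsurj : Function.Surjective (algebraMap A B)) [Module.Finite A M] {ι : Type*} (m : ι → M)
    (hm : Submodule.span B (Set.range fun i => (1 : B) ⊗ₜ[A] m i) = ⊤) :
    Submodule.span A (Set.range m) = ⊤ := by
  set N := Submodule.span A (Set.range m) with hN
  have hzero : (N.mkQ).baseChange B = 0 := by
    refine LinearMap.ext_on_range hm fun i => ?_
    have : N.mkQ (m i) = 0 := by
      rw [Submodule.mkQ_apply, Submodule.Quotient.mk_eq_zero]
      exact Submodule.subset_span ⟨i, rfl⟩
    simp only [LinearMap.baseChange_tmul, this, TensorProduct.tmul_zero, LinearMap.zero_apply]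
  have hs : Function.Surjective ((N.mkQ).baseChange B) :=
    LinearMap.lTensor_surjective B N.mkQ_surjective
  have : Subsingleton (B ⊗[A] (M ⧸ N)) := by
    refine ⟨fun x y => ?_⟩
    obtain ⟨x, rfl⟩ := hs x
    obtain ⟨y, rfl⟩ := hs y
    simp [hzero]
  have := subsingleton_of_subsingleton_tensorProduct (M := M ⧸ N) hsurj
  exact Submodule.Quotient.subsingleton_iff.1 this

/-- The rank of a free localization of `M` agrees with the rank of a free base change of `M` to
a domain in which the inverted elements stay nonzero. -/
theorem finrank_localizedModule_eq [IsDomain B] (S : Submonoid A)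
    (hS : S ≤ (nonZeroDivisors B).comap (algebraMap A B))
    [Module.Free (Localization S) (LocalizedModule S M)] [Module.Free B (B ⊗[A] M)] :
    Nontrivial (Localization S) ∧
    Module.finrank (Localization S) (LocalizedModule S M) = Module.finrank B (B ⊗[A] M) := by
  let K := FractionRing B
  have hu : ∀ s : S, IsUnit (algebraMap A K s) := fun s => by
    rw [IsScalarTower.algebraMap_apply A B K]
    exact IsLocalization.map_units K (⟨_, hS s.2⟩ : nonZeroDivisors B)
  -- This map lets both ranks be read off as the dimension of `K ⊗ M`.
  let φ : Localization S →+* K := IsLocalization.lift hu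
  have : Nontrivial (Localization S) := φ.domain_nontrivial
  refine ⟨this, ?_⟩
  algebraize [φ]
  have : IsScalarTower A (Localization S) K := IsScalarTower.of_algebraMap_eq fun a =>
    (IsLocalization.lift_eq hu a).symm
  let e₀ := (IsLocalizedModule.isBaseChange S (Localization S)
    (LocalizedModule.mkLinearMap S M)).equiv
  have : Module.Free (Localization S) (Localization S ⊗[A] M) := Module.Free.of_equiv e₀.symm
  rw [← e₀.finrank_eq, ← Module.finrank_baseChange (R := K) (S := Localization S),
    ← Module.finrank_baseChange (R := K) (S := B),
    (TensorProduct.AlgebraTensorModule.cancelBaseChange A (Localization S) K K M).finrank_eq,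
    (TensorProduct.AlgebraTensorModule.cancelBaseChange A B K K M).finrank_eq]

/-- A finite module that becomes free after inverting nonzerodivisors, and whose base change along
a surjective local homomorphism is free, is free. -/
theorem free_of_free_localizedModule_of_free_tensorProduct [IsDomain B]
    [IsLocalHom (algebraMap A B)] (hsurj : Function.Surjective (algebraMap A B))
    (S : Submonoid A) (hSA : S ≤ nonZeroDivisors A)
    (hSB : S ≤ (nonZeroDivisors B).comap (algebraMap A B)) [Module.Finite A M]
    [Module.Free (Localization S) (LocalizedModule S M)] [Module.Free B (B ⊗[A] M)] :
    Module.Free A M := by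
  obtain ⟨_, hrank⟩ := finrank_localizedModule_eq (M := M) S hSB
  let b := Module.finBasis B (B ⊗[A] M)
  choose m hm using fun i => TensorProduct.mk_surjective A M B hsurj (b i)
  have hspan : Submodule.span A (Set.range m) = ⊤ := by
    refine span_eq_top_of_span_one_tmul_eq_top hsurj m ?_
    rw [← b.span_eq]
    congr 2
    exact funext hm
  let m' := fun i => LocalizedModule.mkLinearMap S M (m i)
  have hspan' : Submodule.span (Localization S) (Set.range m') = ⊤ := by
    have := span_eq_top_of_isLocalizedModule (Localization S) S
      (LocalizedModule.mkLinearMap S M) hspan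
    rwa [← Set.range_comp] at this
  have : Module.Finite (Localization S) (LocalizedModule S M) :=
    ⟨⟨(Set.finite_range m').toFinset, by simpa using hspan'⟩⟩
  have hli' : LinearIndependent (Localization S) m' := by
    rw [linearIndependent_iff_injective_fintypeLinearCombination]
    -- A surjection between finite free modules of equal rank is injective.
    refine (OrzechProperty.bijective_of_surjective_of_finrank_le _ ?_ (by simp [hrank])).1
    rw [← LinearMap.range_eq_top, Fintype.range_linearCombination, hspan']
  have : FaithfulSMul A (Localization S) :=
    (faithfulSMul_iff_algebraMap_injective _ _).2 (IsLocalization.injective _ hSA)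
  have hli : LinearIndependent A m := by
    have h := hli'.restrict_scalars' A
    -- A relation among the `m i` persists in the localization; injectivity of `M → S⁻¹M` is not
    -- needed.
    exact h.of_comp (LocalizedModule.mkLinearMap S M)
  exact Module.Free.of_basis (Module.Basis.mk hli hspan.ge)

end CommutativeAlgebra

/-! ### Torsion and freeness over a valuation ring. -/

theorem isPTorsionFree_of_free (p : ℕ) {R N : Type*} [CommRing R] [IsDomain R] (hp : (p : R) ≠ 0)
    [AddCommGroup N] [Module R N] [Module.Free R N] : IsPTorsionFree p N := by
  intro x hx
  rw [← Nat.cast_smul_eq_nsmul R] at hx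
  exact (smul_eq_zero.1 hx).resolve_left hp

/-- A `p`-torsion-free finite module over a valuation ring whose topology is `p`-adic is free. -/
theorem IsPTorsionFree.free {p : ℕ} {R N : Type*} [CommRing R] [IsDomain R] [ValuationRing R]
    (hdvd : ∀ r : R, r ≠ 0 → ∃ n : ℕ, r ∣ (p : R) ^ n)
    [AddCommGroup N] [Module R N] [Module.Finite R N] (h : IsPTorsionFree p N) :
    Module.Free R N := by
  have hpow : ∀ (n : ℕ) (x : N), (p : R) ^ n • x = 0 → x = 0 := by
    intro n
    induction n with
    | zero => simp
    | succ n ih =>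
      intro x hx
      rw [pow_succ, mul_smul] at hx
      exact h x (by simpa [Nat.cast_smul_eq_nsmul] using ih _ hx)
  have : Module.Flat R N := by
    rw [Module.Flat.flat_iff_torsion_eq_bot_of_isBezout, eq_bot_iff]
    rintro x ⟨⟨r, hr⟩, hrx⟩
    -- Writing `p ^ n = r * s` turns `r`-torsion into `p ^ n`-torsion.
    obtain ⟨n, s, hs⟩ := hdvd r (nonZeroDivisors.ne_zero hr)
    refine hpow n x ?_
    rw [hs, mul_comm, mul_smul]
    simpa using congrArg (s • ·) hrx
  exact Module.free_of_flat_of_isLocalRing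


/-! ### The two specialisations of `𝔸_inf`. -/

theorem preTilt_isUnit_of_coeff_zero {O : Type*} [CommRing O] {p : ℕ} [Fact p.Prime]
    [Fact (¬ IsUnit (p : O))] {x : PreTilt O p} (hx : IsUnit (PreTilt.coeff 0 x)) : IsUnit x := by
  have hp : p ≠ 0 := (Fact.out : p.Prime).ne_zero
  -- Each coefficient is the `p`-th power of the next, so invertibility propagates upwards, and the
  -- inverses form a compatible sequence.
  have h : ∀ n, IsUnit (PreTilt.coeff n x) := fun n => by
    induction n with
    | zero => exact hx
    | succ n ih => rwa [← PreTilt.coeff_pow_p, isUnit_pow_iff hp] at ih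
  let y : PreTilt O p := (⟨fun n => ((h n).unit⁻¹ : (ModP O p)ˣ), fun n => by
    rw [← Units.val_pow_eq_pow_val, inv_pow]
    congr 2
    ext
    exact PreTilt.coeff_pow_p x n⟩ : Perfection (ModP O p) p)
  refine IsUnit.of_mul_eq_one y (Perfection.ext fun n => ?_)
  change PreTilt.coeff n (x * y) = PreTilt.coeff n 1
  rw [map_mul, map_one]
  exact (h n).mul_val_inv

section Rings

variable (C : Type u) [NormedField C] [IsUltrametricDist C]

theorem exists_integers_pow_eq [IsAlgClosed C] {n : ℕ} (hn : 0 < n) (x : Integers C) :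
    ∃ y : Integers C, y ^ n = x := by
  obtain ⟨z, hz⟩ := IsAlgClosed.exists_pow_nat_eq (x : C) hn
  have hz1 : ‖z‖ ≤ 1 := by
    have := norm_integers_le_one C x
    rw [← hz, norm_pow] at this
    exact (pow_le_one_iff_of_nonneg (norm_nonneg z) hn.ne').1 this
  have hmem : z ∈ (NormedField.valuation (K := C)).valuationSubring := by
    rw [Valuation.mem_valuationSubring_iff]
    exact_mod_cast hz1
  exact ⟨⟨z, hmem⟩, by ext; simpa using hz⟩

variable (p : ℕ) [CharP (Residue C) p]

theorem integers_dvd_prime_pow [CharZero C] (x : Integers C) (hx : x ≠ 0) :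
    ∃ n : ℕ, x ∣ (p : Integers C) ^ n := by
  have hx0 : 0 < ‖(x : C)‖ := norm_pos_iff.2 (by simpa using hx)
  obtain ⟨n, hn⟩ := exists_pow_lt_of_lt_one hx0 (norm_prime_lt_one C p)
  refine ⟨n, ?_⟩
  have hmem : (p : C) ^ n / (x : C) ∈ (NormedField.valuation (K := C)).valuationSubring := by
    rw [Valuation.mem_valuationSubring_iff]
    have : ‖(p : C) ^ n / (x : C)‖ ≤ 1 := by
      rw [norm_div, norm_pow]
      exact (div_le_one hx0).2 hn.le
    exact_mod_cast this
  refine ⟨⟨_, hmem⟩, ?_⟩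
  ext
  simp [mul_div_cancel₀, norm_pos_iff.1 hx0]

variable [Fact p.Prime]

theorem frobenius_modP_surjective [IsAlgClosed C] :
    Function.Surjective (frobenius (ModP (Integers C) p) p) := by
  intro x
  obtain ⟨x, rfl⟩ := Ideal.Quotient.mk_surjective x
  obtain ⟨y, rfl⟩ := exists_integers_pow_eq C (Fact.out : p.Prime).pos x
  exact ⟨Ideal.Quotient.mk _ y, by simp [frobenius_def]⟩

/-- Perfectness of `k` makes `W(k)` a discrete valuation ring with uniformizer `p`. -/
instance perfectRing_residue [IsAlgClosed C] : PerfectRing (Residue C) p := by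
  refine PerfectRing.ofSurjective _ _ fun x => ?_
  obtain ⟨x, rfl⟩ := IsLocalRing.residue_surjective x
  obtain ⟨y, rfl⟩ := exists_integers_pow_eq C (Fact.out : p.Prime).pos x
  exact ⟨IsLocalRing.residue _ y, by simp [frobenius_def]⟩

theorem tiltToResidue_surjective [IsAlgClosed C] : Function.Surjective (tiltToResidue C p) := by
  have h := Perfection.coeff_surjective (frobenius_modP_surjective C p) 0
  exact (Ideal.Quotient.lift_surjective_of_surjective _ (residue_eq_zero_of_mem_span C p)
    IsLocalRing.residue_surjective).comp h

instance isLocalHom_quotientLift_residue : IsLocalHom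
    (Ideal.Quotient.lift (Ideal.span {(p : Integers C)}) (IsLocalRing.residue (Integers C))
      (residue_eq_zero_of_mem_span C p)) where
  map_nonunit x hx := by
    obtain ⟨x, rfl⟩ := Ideal.Quotient.mk_surjective x
    rw [Ideal.Quotient.lift_mk] at hx
    exact (isUnit_of_map_unit _ x hx).map _

/-- Common source of locality for both specialisations: units of `𝔸_inf` are already detected in
`𝒪/p`. -/
theorem ainf_isUnit_of_coeff_zero_coeff_zero {x : Ainf C p}
    (hx : IsUnit (PreTilt.coeff 0 (x.coeff 0))) : IsUnit x :=
  (WittVector.mkUnit (preTilt_isUnit_of_coeff_zero hx).unit_spec.symm).isUnit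

instance isLocalHom_algebraMap_wittResidue :
    IsLocalHom (algebraMap (Ainf C p) (WittResidue C p)) where
  map_nonunit x hx := by
    have h : IsUnit (tiltToResidue C p (x.coeff 0)) := by
      have := hx.map (WittVector.constantCoeff (p := p) (R := Residue C))
      simpa [crystallineMap, RingHom.algebraMap_toAlgebra] using this
    exact ainf_isUnit_of_coeff_zero_coeff_zero C p (isUnit_of_map_unit
      (Ideal.Quotient.lift (Ideal.span {(p : Integers C)}) (IsLocalRing.residue (Integers C))
        (residue_eq_zero_of_mem_span C p)) _ h)

theorem algebraMap_wittResidue_surjective [IsAlgClosed C] :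
    Function.Surjective (algebraMap (Ainf C p) (WittResidue C p)) :=
  WittVector.map_surjective _ (tiltToResidue_surjective C p)

theorem wittResidue_dvd_prime_pow [IsAlgClosed C] (x : WittResidue C p) (hx : x ≠ 0) :
    ∃ n : ℕ, x ∣ (p : WittResidue C p) ^ n := by
  obtain ⟨n, b, rfl⟩ := WittVector.exists_eq_pow_p_mul' x hx
  exact ⟨n, by simp⟩

theorem powers_le_nonZeroDivisors_ainf :
    Submonoid.powers (p : Ainf C p) ≤ nonZeroDivisors (Ainf C p) := by
  rw [Submonoid.powers_le, mem_nonZeroDivisors_iff_right]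
  exact WittVector.eq_zero_of_p_mul_eq_zero

theorem powers_le_comap_nonZeroDivisors {B : Type*} [CommRing B] [IsDomain B]
    [Algebra (Ainf C p) B] (hp : (p : B) ≠ 0) :
    Submonoid.powers (p : Ainf C p) ≤ (nonZeroDivisors B).comap (algebraMap (Ainf C p) B) := by
  rw [Submonoid.powers_le, Submonoid.mem_comap, map_natCast]
  exact mem_nonZeroDivisors_of_ne_zero hp

variable [CompleteSpace C] [CharZero C]

instance isLocalHom_algebraMap_integers : IsLocalHom (algebraMap (Ainf C p) (Integers C)) where
  map_nonunit x hx := by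
    refine ainf_isUnit_of_coeff_zero_coeff_zero C p ?_
    -- Modulo `p`, `θ(x)` is the zeroth coefficient of `x.coeff 0`.
    rw [← WittVector.mk_fontaineTheta]
    exact hx.map _

theorem algebraMap_integers_surjective [IsAlgClosed C] :
    Function.Surjective (algebraMap (Ainf C p) (Integers C)) :=
  surjective_fontaineTheta (frobenius_modP_surjective C p)

end Rings

end AinfModules

theorem mainTheorem11 (p : ℕ) [Fact p.Prime]
    (C : Type*) [NormedField C] [IsUltrametricDist C] [CompleteSpace C] [IsAlgClosed C]
    [CharZero C] [CharP (AinfModules.Residue C) p]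
    (M : Type*) [AddCommGroup M] [Module (AinfModules.Ainf C p) M]
    [Module.FinitePresentation (AinfModules.Ainf C p) M]
    (hM : AinfModules.IsFiniteFree
      (Localization (Submonoid.powers (p : AinfModules.Ainf C p)))
      (LocalizedModule (Submonoid.powers (p : AinfModules.Ainf C p)) M)) :
    (AinfModules.IsPTorsionFree p
        (AinfModules.WittResidue C p ⊗[AinfModules.Ainf C p] M) ↔
      AinfModules.IsFiniteFree (AinfModules.WittResidue C p)
        (AinfModules.WittResidue C p ⊗[AinfModules.Ainf C p] M)) ∧
    (AinfModules.IsPTorsionFree p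
        (AinfModules.Integers C ⊗[AinfModules.Ainf C p] M) ↔
      AinfModules.IsFiniteFree (AinfModules.Integers C)
        (AinfModules.Integers C ⊗[AinfModules.Ainf C p] M)) ∧
    (AinfModules.IsPTorsionFree p
        (AinfModules.WittResidue C p ⊗[AinfModules.Ainf C p] M) ∨
      AinfModules.IsPTorsionFree p
        (AinfModules.Integers C ⊗[AinfModules.Ainf C p] M) →
      AinfModules.IsFiniteFree (AinfModules.Ainf C p) M) := by
  open AinfModules in
  have := hM.2
  have hpW : (p : WittResidue C p) ≠ 0 := WittVector.p_nonzero p _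
  have hpO : (p : Integers C) ≠ 0 := Nat.cast_ne_zero.2 (Fact.out : p.Prime).ne_zero
  have hW (h : IsPTorsionFree p (WittResidue C p ⊗[Ainf C p] M)) :
      Module.Free (WittResidue C p) (WittResidue C p ⊗[Ainf C p] M) :=
    h.free (wittResidue_dvd_prime_pow C p)
  have hO (h : IsPTorsionFree p (Integers C ⊗[Ainf C p] M)) :
      Module.Free (Integers C) (Integers C ⊗[Ainf C p] M) :=
    h.free (integers_dvd_prime_pow C p)
  refine ⟨⟨fun h => ⟨inferInstance, hW h⟩, fun ⟨_, _⟩ => isPTorsionFree_of_free p hpW⟩,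
    ⟨fun h => ⟨inferInstance, hO h⟩, fun ⟨_, _⟩ => isPTorsionFree_of_free p hpO⟩, ?_⟩
  rintro (h | h)
  · have := hW h
    exact ⟨inferInstance, free_of_free_localizedModule_of_free_tensorProduct
      (algebraMap_wittResidue_surjective C p) _ (powers_le_nonZeroDivisors_ainf C p)
      (powers_le_comap_nonZeroDivisors C p hpW)⟩
  · have := hO h
    exact ⟨inferInstance, free_of_free_localizedModule_of_free_tensorProduct
      (algebraMap_integers_surjective C p) _ (powers_le_nonZeroDivisors_ainf C p)
      (powers_le_comap_nonZeroDivisors C p hpO)⟩
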